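/- Let $M^m$ be a connected smooth Riemannian manifold, let $F\colon M^m\to\mathbb{R}^{n+k+1}$ be an isometric immersion (smooth, with $\langle F_*X,F_*Y\rangle=\langle X,Y\rangle$), and let $E_1,\dots,E_{n+k+1}$ be a parallel (that is, constant) orthonormal frame of $\mathbb{R}^{n+k+1}$. For $p\in M$ let $T_j$ denote the orthogonal projection of $E_j$ onto the tangent space $F_*T_pM$, and let $\Delta F$ be the vector of the Laplacians ($\Delta h=\operatorname{trace}\operatorname{Hess}h$) of the coordinate functions of $F$. Suppose that for some constant $c\neq 0$, on all of $M$, \[ \Delta F=-c\Bigl(m-\sum_{j=n+2}^{n+k+1}\|T_j\|^2\Bigr)\Bigl(F-\sum_{j=n+2}^{n+k+1}\langle F,E_j\rangle E_j\Bigr), \] and that $\sum_{j=n+2}^{n+k+1}\|T_j\|^2$ is not identically equal to $m$ (equivalently, $F(M)$ is not contained in a translate of $\operatorname{span}\{E_{n+2},\dots,E_{n+k+1}\}$). Then $c>0$, and there is a minimal isometric immersion $f\colon M^m\to\mathbb{S}^n_c\times\mathbb{R}^k$ (an isometric immersion whose mean curvature vector vanishes) such that $F=i\circ f$. Here $\mathbb{S}^n_c=\{X\in\mathbb{R}^{n+1}:\langle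 X,X\rangle=1/c\}$ is the sphere of constant curvature $c$, $\mathbb{S}^n_c\times\mathbb{R}^k$ carries the product metric, and $i\colon\mathbb{S}^n_c\times\mathbb{R}^k\to\mathbb{R}^{n+k+1}$ is the canonical inclusion $i(x,y)=\sum_{a=1}^{n+1}x_aE_a+\sum_{j=1}^{k}y_jE_{n+1+j}$. -/

import Mathlib

open scoped Manifold ContDiff
open Module

noncomputable section

namespace CylinderImmersion

/-- A smooth Riemannian metric on the tangent bundle of `M`. All manifolds below are used with a
boundaryless model `I`. -/
abbrev SmoothMetric {E H : Type*} [NormedAddCommGroup E] [NormedSpace ℝ E] [TopologicalSpace H]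
    (I : ModelWithCorners ℝ E H) (M : Type*) [TopologicalSpace M] [ChartedSpace H M]
    [IsManifold I 1 M] :=
  Bundle.ContMDiffRiemannianMetric I ∞ E (fun p : M => TangentSpace I p)

section
variable {E H M V : Type*} [NormedAddCommGroup E] [NormedSpace ℝ E]
    [TopologicalSpace H] {I : ModelWithCorners ℝ E H} [TopologicalSpace M] [ChartedSpace H M]
    [NormedAddCommGroup V] [InnerProductSpace ℝ V]

/-- The pull-back `⟪dΦ v, dΦ w⟫` of the inner product of `V` along `Φ`. -/
def pullbackInner (I : ModelWithCorners ℝ E H) (Φ : M → V) (q : M) :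
    TangentSpace I q →L[ℝ] TangentSpace I q →L[ℝ] ℝ :=
  let A : E →L[ℝ] V := mvfderiv I Φ q
  ((innerSL ℝ).bilinearComp A A : E →L[ℝ] E →L[ℝ] ℝ)

theorem pullbackInner_apply (Φ : M → V) (q : M) (v w : TangentSpace I q) :
    pullbackInner I Φ q v w = inner ℝ (mvfderiv I Φ q v) (mvfderiv I Φ q w) := rfl

theorem contDiff_bilinearComp_self {E V : Type*} [NormedAddCommGroup E] [NormedSpace ℝ E]
    [NormedAddCommGroup V] [NormedSpace ℝ V] (B : V →L[ℝ] V →L[ℝ] ℝ) :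
    ContDiff ℝ ∞ (fun A : E →L[ℝ] V => (B.bilinearComp A A : E →L[ℝ] E →L[ℝ] ℝ)) := by
  have h0 : ContDiff ℝ ∞ (fun A : E →L[ℝ] V => B.comp A) := contDiff_const.clm_comp contDiff_id
  have h1 : ContDiff ℝ ∞ (fun A : E →L[ℝ] V => (ContinuousLinearMap.compL ℝ E V ℝ).flip A) :=
    ContinuousLinearMap.contDiff (𝕜 := ℝ) (E := E →L[ℝ] V) (F := (V →L[ℝ] ℝ) →L[ℝ] (E →L[ℝ] ℝ))
      (ContinuousLinearMap.compL ℝ E V ℝ).flip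
  exact h1.clm_comp h0

/-- The Riemannian metric induced on `M` by a smooth immersion `Φ` into an inner product space. -/
def inducedMetric [FiniteDimensional ℝ E] [IsManifold I ∞ M] (Φ : M → V)
    (hΦ : ContMDiff I 𝓘(ℝ, V) ∞ Φ)
    (hinj : ∀ q, Function.Injective (mvfderiv I Φ q)) : SmoothMetric I M where
  inner q := pullbackInner I Φ q
  symm q v w := by
    rw [pullbackInner_apply, pullbackInner_apply, real_inner_comm]
  pos q v hv := by
    rw [pullbackInner_apply, real_inner_self_pos]
    exact fun h => hv (hinj q (h.trans (map_zero _).symm))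
  isVonNBounded q := by
    let A : E →L[ℝ] V := mvfderiv I Φ q
    have hA0 : Function.Injective A := hinj q
    obtain ⟨K, hK, hA⟩ := LinearMap.exists_antilipschitzWith
      (A : E →ₗ[ℝ] V) (LinearMap.ker_eq_bot.2 hA0)
    have hsub : {v : E | inner ℝ (A v) (A v) < 1} ⊆ Metric.ball 0 (K : ℝ) := by
      intro v hv
      have h1 := hA.le_mul_dist v 0
      have hv' : ‖A v‖ ^ 2 < 1 := by
        rw [← real_inner_self_eq_norm_sq]; exact hv
      have h2 : ‖A v‖ < 1 := by nlinarith [norm_nonneg (A v)]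
      have h3 : dist v 0 ≤ K * ‖A v‖ := by
        simpa [dist_zero_right] using h1
      rw [Metric.mem_ball]
      have hK' : (0 : ℝ) < K := hK
      nlinarith
    exact (NormedSpace.isVonNBounded_ball ℝ E (K : ℝ)).subset hsub
  contMDiff := by
    intro x
    rw [Bundle.contMDiffAt_section]
    have h1 : ContMDiffAt I 𝓘(ℝ, E →L[ℝ] V) ∞
        (inTangentCoordinates I 𝓘(ℝ, V) id Φ (fun y => mfderiv I 𝓘(ℝ, V) Φ y) x) x :=
      (hΦ.contMDiffAt (x := x)).mfderiv_const (m := ∞) le_rfl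
    have h2 := contDiff_bilinearComp_self (E := E) (innerSL ℝ : V →L[ℝ] V →L[ℝ] ℝ)
    have h3 := h2.contMDiff.contMDiffAt.comp x h1
    refine h3.congr_of_eventuallyEq ?_
    filter_upwards [(trivializationAt E (TangentSpace I) x).open_baseSet.mem_nhds
      (FiberBundle.mem_baseSet_trivializationAt' x)] with y hy
    ext v w
    rw [hom_trivializationAt_apply, inCoordinates_apply_eq₂ hy hy (Set.mem_univ _)]
    have key (z : E) : inTangentCoordinates I 𝓘(ℝ, V) id Φ (fun y => mfderiv I 𝓘(ℝ, V) Φ y) x y z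
        = mvfderiv I Φ y ((trivializationAt E (TangentSpace I) x).symm y z) := by
      rw [← Bundle.Trivialization.symmL_apply (R := ℝ) _ hy]
      simp [inTangentCoordinates, ContinuousLinearMap.inCoordinates]
      rfl
    simp only [Bundle.Trivial.fiberBundle_trivializationAt', Bundle.Trivial.linearMapAt_trivialization,
      LinearMap.id_coe, id_eq]
    exact (congrArg₂ (inner ℝ) (key v) (key w)).symm

end

section
variable {E H M : Type*} [NormedAddCommGroup E] [NormedSpace ℝ E] [FiniteDimensional ℝ E]
    [TopologicalSpace H] {I : ModelWithCorners ℝ E H} [TopologicalSpace M] [ChartedSpace H M]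
    [IsManifold I 1 M]

open scoped Bundle in
/-- An orthonormal basis of the tangent space at `p` for the metric `g`.
Mathlib's `TangentSpace I p` is the model space `E`, identified through the preferred chart at `p`. -/
def orthonormalFrame (g : SmoothMetric I M) (p : M) : Fin (finrank ℝ E) → TangentSpace I p :=
  letI : Bundle.RiemannianBundle (fun p : M => TangentSpace I p) := ⟨g.toRiemannianMetric⟩
  haveI : FiniteDimensional ℝ (TangentSpace I p) := inferInstanceAs (FiniteDimensional ℝ E)
  stdOrthonormalBasis ℝ (TangentSpace I p)

open scoped Bundle in
theorem orthonormalFrame_inner (g : SmoothMetric I M) (p : M) (a b : Fin (finrank ℝ E)) :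
    g.inner p (orthonormalFrame g p a) (orthonormalFrame g p b) = if a = b then 1 else 0 := by
  let : Bundle.RiemannianBundle (fun p : M => TangentSpace I p) := ⟨g.toRiemannianMetric⟩
  have : FiniteDimensional ℝ (TangentSpace I p) := inferInstanceAs (FiniteDimensional ℝ E)
  exact orthonormal_iff_ite.1 (stdOrthonormalBasis ℝ (TangentSpace I p)).orthonormal a b

/-- The coefficient `g(v, w)` of the metric in the preferred chart at `p`, as a function of the point
`x` of the chart, for coordinate vectors `v`, `w`. -/
def chartMetric (g : SmoothMetric I M) (p : M) (v w x : E) : ℝ :=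
  g.inner ((extChartAt I p).symm x)
    (mfderiv 𝓘(ℝ, E) I (extChartAt I p).symm x v)
    (mfderiv 𝓘(ℝ, E) I (extChartAt I p).symm x w)

/-- Christoffel symbols of the first kind at `p`:
`⟨∇_v w, z⟩ = (∂_v g(w, z) + ∂_w g(v, z) - ∂_z g(v, w)) / 2` for constant coordinate fields. -/
def christoffelFirst (g : SmoothMetric I M) (p : M) (v w z : E) : ℝ :=
  (fderiv ℝ (chartMetric g p w z) (extChartAt I p p) v
    + fderiv ℝ (chartMetric g p v z) (extChartAt I p p) w
    - fderiv ℝ (chartMetric g p v w) (extChartAt I p p) z) / 2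

/-- The Levi-Civita derivative `∇_v w` at `p` of the constant coordinate field `w` of the preferred
chart at `p` (Christoffel symbols of the second kind): the vector `Γ` with
`⟨Γ, z⟩ = christoffelFirst g p v w z`, expanded in an orthonormal basis. -/
def christoffel (g : SmoothMetric I M) (p : M) (v w : E) : E :=
  ∑ a, christoffelFirst g p v w (orthonormalFrame g p a) • (orthonormalFrame g p a : E)

/-- The Hessian `Hess h (X, Y) = X Y h - (∇_X Y) h` at `p`. -/
def hessian (g : SmoothMetric I M) (h : M → ℝ) (p : M) (v w : TangentSpace I p) : ℝ :=
  fderiv ℝ (fderiv ℝ (h ∘ (extChartAt I p).symm)) (extChartAt I p p) v w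
    - fderiv ℝ (h ∘ (extChartAt I p).symm) (extChartAt I p p) (christoffel g p v w)

/-- The Laplacian `Δ h = trace Hess h`. -/
def laplacian (g : SmoothMetric I M) (h : M → ℝ) (p : M) : ℝ :=
  ∑ a, hessian g h p (orthonormalFrame g p a) (orthonormalFrame g p a)

/-- The componentwise Laplacian `Δ F = (Δ F₁, …, Δ F_N)`. -/
def vectorLaplacian {N : ℕ} (g : SmoothMetric I M) (F : M → EuclideanSpace ℝ (Fin N)) (p : M) :
    EuclideanSpace ℝ (Fin N) :=
  WithLp.toLp 2 fun i => laplacian g (fun q => F q i) p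

/-- The orthogonal projection of `v` onto the tangent space `dF (T_p M)`. For an isometric immersion
its norm is the norm of the corresponding vector of `T_p M`. -/
def tangentialProjection {N : ℕ} (I : ModelWithCorners ℝ E H) (F : M → EuclideanSpace ℝ (Fin N))
    (p : M) (v : EuclideanSpace ℝ (Fin N)) : EuclideanSpace ℝ (Fin N) :=
  (mvfderiv I F p).range.starProjection v

end

section
variable {E H M : Type*} [NormedAddCommGroup E] [NormedSpace ℝ E] [FiniteDimensional ℝ E]
    [TopologicalSpace H] {I : ModelWithCorners ℝ E H} [TopologicalSpace M] [ChartedSpace H M]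
    [IsManifold I 1 M]
    {E' H' N : Type*} [NormedAddCommGroup E'] [NormedSpace ℝ E'] [FiniteDimensional ℝ E']
    [TopologicalSpace H'] {J : ModelWithCorners ℝ E' H'} [TopologicalSpace N] [ChartedSpace H' N]
    [IsManifold J 1 N]

/-- `f` is a smooth map with `⟨df v, df w⟩ = ⟨v, w⟩`; it is then automatically an immersion. -/
structure IsIsometricImmersion (gM : SmoothMetric I M) (gN : SmoothMetric J N) (f : M → N) :
    Prop where
  smooth : ContMDiff I J ∞ f
  isometric : ∀ (p : M) (v w : TangentSpace I p),
    gN.inner (f p) (mfderiv I J f p v) (mfderiv I J f p w) = gM.inner p v w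

/-- The second fundamental form `α(X, Y) = ∇^N_X f_* Y - f_* ∇^M_X Y` of `f` at `p`, in the preferred
charts at `p` and `f p`: `D²f(v, w) - Df(Γ^M(v, w)) + Γ^N(Df v, Df w)`. -/
def secondFundamentalForm (gM : SmoothMetric I M) (gN : SmoothMetric J N) (f : M → N) (p : M)
    (v w : TangentSpace I p) : TangentSpace J (f p) :=
  let f' : E → E' := writtenInExtChartAt I J p f
  let x : E := extChartAt I p p
  (fderiv ℝ (fderiv ℝ f') x v w - fderiv ℝ f' x (christoffel gM p v w)
    + christoffel gN (f p) (fderiv ℝ f' x v) (fderiv ℝ f' x w) : E')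

/-- The mean curvature vector `H = (1 / dim M) trace α`. -/
def meanCurvature (gM : SmoothMetric I M) (gN : SmoothMetric J N) (f : M → N) (p : M) :
    TangentSpace J (f p) :=
  (finrank ℝ E : ℝ)⁻¹ •
    ∑ a, secondFundamentalForm gM gN f p (orthonormalFrame gM p a) (orthonormalFrame gM p a)

/-- An isometric immersion is minimal if its mean curvature vector field vanishes. -/
structure IsMinimalIsometricImmersion (gM : SmoothMetric I M) (gN : SmoothMetric J N)
    (f : M → N) : Prop extends IsIsometricImmersion gM gN f where
  meanCurvature_eq_zero : ∀ p, meanCurvature gM gN f p = 0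

end

/-- The standard Riemannian metric of an inner product space. -/
def euclideanMetric (V : Type*) [NormedAddCommGroup V] [InnerProductSpace ℝ V] :
    SmoothMetric 𝓘(ℝ, V) V where
  __ := riemannianMetricVectorSpace V
  contMDiff := (riemannianMetricVectorSpace V).contMDiff.of_le le_top

section Cylinder

open Metric

/-- The manifold `S^n × ℝ^k`. With `cylinderMetric n k hc` it is the Riemannian product of the sphere
`S^n_c` of constant curvature `c` and `ℝ^k`: the point `(x, y)`, `‖x‖ = 1`, stands for the point
`(x / √c, y)` of `{X | ⟨X, X⟩ = 1 / c} × ℝ^k`. -/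
abbrev Cylinder (n k : ℕ) : Type :=
  sphere (0 : EuclideanSpace ℝ (Fin (n + 1))) 1 × EuclideanSpace ℝ (Fin k)

abbrev cylinderModel (n k : ℕ) := (𝓡 n).prod 𝓘(ℝ, EuclideanSpace ℝ (Fin k))

variable {n k : ℕ}

/-- The embedding `(x, y) ↦ (x / √c, y)` with image `{X | ⟨X, X⟩ = 1 / c} × ℝ^k` in the orthogonal
product `ℝ^{n+1} × ℝ^k`. -/
def cylinderEmbedding (c : ℝ) (q : Cylinder n k) :
    WithLp 2 (EuclideanSpace ℝ (Fin (n + 1)) × EuclideanSpace ℝ (Fin k)) :=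
  WithLp.toLp 2 ((√c)⁻¹ • (q.1 : EuclideanSpace ℝ (Fin (n + 1))), q.2)

theorem contMDiff_cylinderEmbedding (c : ℝ) :
    ContMDiff (cylinderModel n k)
      𝓘(ℝ, WithLp 2 (EuclideanSpace ℝ (Fin (n + 1)) × EuclideanSpace ℝ (Fin k))) ∞
      (cylinderEmbedding c : Cylinder n k → _) := by
  have := Fact.mk (@finrank_euclideanSpace_fin ℝ _ (n + 1))
  have h1 : ContMDiff (cylinderModel n k) 𝓘(ℝ, EuclideanSpace ℝ (Fin (n + 1))) ∞
      (fun q : Cylinder n k => (√c)⁻¹ • (q.1 : EuclideanSpace ℝ (Fin (n + 1)))) :=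
    (contDiff_const_smul (√c)⁻¹).contMDiff.comp (contMDiff_coe_sphere.comp contMDiff_fst)
  have h2 : ContMDiff (cylinderModel n k) 𝓘(ℝ, EuclideanSpace ℝ (Fin k)) ∞
      (fun q : Cylinder n k => q.2) := contMDiff_snd
  exact (WithLp.prodContinuousLinearEquiv 2 ℝ (EuclideanSpace ℝ (Fin (n + 1)))
    (EuclideanSpace ℝ (Fin k))).symm.contDiff.contMDiff.comp (h1.prodMk_space h2)

theorem mvfderiv_cylinderEmbedding (c : ℝ) (q : Cylinder n k)
    (v : TangentSpace (cylinderModel n k) q) :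
    mvfderiv (cylinderModel n k) (cylinderEmbedding c) q v =
      WithLp.toLp 2 ((√c)⁻¹ • mvfderiv (𝓡 n) ((↑) : sphere (0 : EuclideanSpace ℝ (Fin (n + 1))) 1 →
        EuclideanSpace ℝ (Fin (n + 1))) q.1 v.1, v.2) := by
  have := Fact.mk (@finrank_euclideanSpace_fin ℝ _ (n + 1))
  have h0 : MDifferentiableAt (𝓡 n) 𝓘(ℝ, EuclideanSpace ℝ (Fin (n + 1)))
      ((↑) : sphere (0 : EuclideanSpace ℝ (Fin (n + 1))) 1 → EuclideanSpace ℝ (Fin (n + 1))) q.1 :=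
    (contMDiff_coe_sphere (m := 1) q.1).mdifferentiableAt one_ne_zero
  have h1 := (h0.hasMFDerivAt.comp q (hasMFDerivAt_fst (I := 𝓡 n) (I' := 𝓘(ℝ, EuclideanSpace ℝ (Fin k)))
    (M := sphere (0 : EuclideanSpace ℝ (Fin (n + 1))) 1) (M' := EuclideanSpace ℝ (Fin k))
    q)).const_smul (√c)⁻¹
  have h1' := hasMFDerivAt_snd (I := 𝓡 n) (I' := 𝓘(ℝ, EuclideanSpace ℝ (Fin k)))
    (M := sphere (0 : EuclideanSpace ℝ (Fin (n + 1))) 1) (M' := EuclideanSpace ℝ (Fin k)) q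
  have h2 : HasMFDerivAt (cylinderModel n k)
      𝓘(ℝ, EuclideanSpace ℝ (Fin (n + 1)) × EuclideanSpace ℝ (Fin k))
      (fun q : Cylinder n k => ((√c)⁻¹ • (q.1 : EuclideanSpace ℝ (Fin (n + 1))), q.2)) q _ :=
    ⟨h1.1.prodMk h1'.1, h1.2.prodMk h1'.2⟩
  have h3 := ((WithLp.prodContinuousLinearEquiv 2 ℝ (EuclideanSpace ℝ (Fin (n + 1)))
    (EuclideanSpace ℝ (Fin k))).symm.toContinuousLinearMap.hasMFDerivAt).comp q h2
  have h4 := h3.mfderiv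
  exact congrArg (fun A => A v) h4

theorem injective_mvfderiv_cylinderEmbedding {c : ℝ} (hc : 0 < c) (q : Cylinder n k) :
    Function.Injective (mvfderiv (cylinderModel n k) (cylinderEmbedding c) q) := by
  have := Fact.mk (@finrank_euclideanSpace_fin ℝ _ (n + 1))
  intro v w h
  rw [mvfderiv_cylinderEmbedding, mvfderiv_cylinderEmbedding] at h
  have h' := congrArg WithLp.ofLp h
  have h0 : (√c)⁻¹ ≠ 0 := inv_ne_zero (Real.sqrt_pos.2 hc).ne'
  obtain ⟨h1, h2⟩ := Prod.mk.inj h'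
  exact Prod.ext (injective_mvfderiv_subtypeVal_sphere q.1 (smul_right_injective _ h0 h1)) h2

/-- The Riemannian metric of `S^n_c × ℝ^k`, induced from `ℝ^{n+1} × ℝ^k`. -/
def cylinderMetric (n k : ℕ) {c : ℝ} (hc : 0 < c) :
    SmoothMetric (cylinderModel n k) (Cylinder n k) :=
  inducedMetric (cylinderEmbedding c) (contMDiff_cylinderEmbedding c)
    (injective_mvfderiv_cylinderEmbedding hc)

theorem cylinderMetric_inner {c : ℝ} (hc : 0 < c) (q : Cylinder n k)
    (v w : TangentSpace (cylinderModel n k) q) :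
    (cylinderMetric n k hc).inner q v w =
      (1 / c) * inner ℝ
        (mvfderiv (𝓡 n) ((↑) : sphere (0 : EuclideanSpace ℝ (Fin (n + 1))) 1 →
          EuclideanSpace ℝ (Fin (n + 1))) q.1 v.1)
        (mvfderiv (𝓡 n) ((↑) : sphere (0 : EuclideanSpace ℝ (Fin (n + 1))) 1 →
          EuclideanSpace ℝ (Fin (n + 1))) q.1 w.1)
      + inner ℝ (v.2 : EuclideanSpace ℝ (Fin k)) (w.2 : EuclideanSpace ℝ (Fin k)) := by
  have h : (√c)⁻¹ * (√c)⁻¹ = 1 / c := by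
    rw [← mul_inv, Real.mul_self_sqrt hc.le, one_div]
  change inner ℝ (mvfderiv (cylinderModel n k) (cylinderEmbedding c) q v)
    (mvfderiv (cylinderModel n k) (cylinderEmbedding c) q w) = _
  rw [mvfderiv_cylinderEmbedding, mvfderiv_cylinderEmbedding, WithLp.prod_inner_apply]
  simp only [inner_smul_left, inner_smul_right, ← mul_assoc, ← h]
  rfl

/-- The indices `1, …, n + 1` (here counted from `0`). -/
def sphereIndex (a : Fin (n + 1)) : Fin (n + k + 1) := ⟨a, by omega⟩

/-- The indices `n + 2, …, n + k + 1` (here counted from `0`). -/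
def lineIndex (j : Fin k) : Fin (n + k + 1) := ⟨n + 1 + j, by omega⟩

/-- The canonical inclusion `i : S^n_c × ℝ^k → ℝ^{n+k+1}` with respect to the orthonormal frame `b`,
with `ℝ^k = span {b_{n+2}, …, b_{n+k+1}}`. -/
def cylinderInclusion
    (b : OrthonormalBasis (Fin (n + k + 1)) ℝ (EuclideanSpace ℝ (Fin (n + k + 1)))) (c : ℝ)
    (q : Cylinder n k) : EuclideanSpace ℝ (Fin (n + k + 1)) :=
  ∑ a : Fin (n + 1), (cylinderEmbedding c q).fst a • b (sphereIndex a)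
    + ∑ j : Fin k, (cylinderEmbedding c q).snd j • b (lineIndex j)

theorem sum_index {A : Type*} [AddCommMonoid A] (u : Fin (n + k + 1) → A) :
    ∑ i, u i = ∑ a : Fin (n + 1), u (sphereIndex a) + ∑ j : Fin k, u (lineIndex j) := by
  have e : n + 1 + k = n + k + 1 := by omega
  rw [← (finCongr e).sum_comp, Fin.sum_univ_add]
  rfl

theorem sphereIndex_inj (a a' : Fin (n + 1)) :
    (sphereIndex a : Fin (n + k + 1)) = sphereIndex a' ↔ a = a' := by
  simp [sphereIndex, Fin.ext_iff]

theorem lineIndex_ne_sphereIndex (a : Fin (n + 1)) (j : Fin k) :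
    (lineIndex j : Fin (n + k + 1)) ≠ sphereIndex a := by
  simp only [sphereIndex, lineIndex, ne_eq, Fin.ext_iff]
  omega

theorem range_cylinderInclusion
    (b : OrthonormalBasis (Fin (n + k + 1)) ℝ (EuclideanSpace ℝ (Fin (n + k + 1)))) {c : ℝ}
    (hc : 0 < c) :
    Set.range (cylinderInclusion b c) =
      {z | ∑ a : Fin (n + 1), inner ℝ z (b (sphereIndex a)) ^ 2 = 1 / c} := by
  ext z
  have hs := Real.sq_sqrt hc.le
  have hs0 := (Real.sqrt_pos.2 hc).ne'
  constructor
  · rintro ⟨q, rfl⟩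
    have h1 : ∑ a : Fin (n + 1), (q.1 : EuclideanSpace ℝ (Fin (n + 1))) a ^ 2 = 1 := by
      have h := norm_eq_of_mem_sphere q.1
      rw [EuclideanSpace.norm_eq, Real.sqrt_eq_one] at h
      simpa using h
    have h2 : ((√c)⁻¹) ^ 2 = 1 / c := by rw [inv_pow, hs, one_div]
    have hin (a : Fin (n + 1)) : inner ℝ (cylinderInclusion b c q) (b (sphereIndex a))
        = (√c)⁻¹ * (q.1 : EuclideanSpace ℝ (Fin (n + 1))) a := by
      simp [cylinderInclusion, cylinderEmbedding, inner_add_left, sum_inner, inner_smul_left,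
        orthonormal_iff_ite.1 b.orthonormal, lineIndex_ne_sphereIndex, sphereIndex_inj]
    simp only [Set.mem_ofPred_eq, hin, mul_pow, ← Finset.mul_sum, h1, h2, mul_one]
  · intro hz
    have hx : WithLp.toLp 2 (fun a : Fin (n + 1) => √c * inner ℝ z (b (sphereIndex a))) ∈
        sphere (0 : EuclideanSpace ℝ (Fin (n + 1))) 1 := by
      rw [mem_sphere_zero_iff_norm, EuclideanSpace.norm_eq, Real.sqrt_eq_one]
      simp only [Real.norm_eq_abs, sq_abs, mul_pow, ← Finset.mul_sum]
      rw [hz, hs, mul_one_div_cancel hc.ne']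
    refine ⟨(⟨_, hx⟩, WithLp.toLp 2 fun j => inner ℝ z (b (lineIndex j))), ?_⟩
    refine Eq.trans ?_ (b.sum_repr' z)
    rw [sum_index]
    simp [cylinderInclusion, cylinderEmbedding, hs0, real_inner_comm]

end Cylinder

end CylinderImmersion

end

open CylinderImmersion

/-! Let `P` (`sphereProjection`) be the orthogonal projection onto the span of the first n+1 frame
vectors, and let τ = Σ_a ⟨P dF e_a, dF e_a⟩ for an orthonormal tangent frame e_a. Then τ = m -
Σ‖T_j‖², so the hypothesis reads ΔF = -cτ PF.

ΔF is the trace of the second fundamental form of F, hence normal to dF (`inner_traceHessian`). So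
cτ⟨PF, dF v⟩ = 0. Where τ ≠ 0 this gives ⟨PF, dF v⟩ = 0; where τ = 0 every P dF e_a vanishes, being
a vector of zero length in a sum of squares, and the conclusion is the same
(`inner_sphereProjection_mvfderiv_eq_zero`). Thus ⟨PF, F⟩ has zero differential and is constant, M
being connected.

Differentiating ⟨PF, dF v⟩ = 0 once more and tracing gives ⟨PF, ΔF⟩ = -τ (`inner_clm_traceHessian`).
Comparison with the hypothesis at a point where τ ≠ 0 yields |PF|² = 1/c
(`inner_sphereProjection_self_eq_one_div`). Hence c > 0 and F factors through the cylinder as i ∘ f.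

PF is normal to the cylinder along f, so ΔF has no component tangent to the cylinder. By the
composition formula for second fundamental forms that component is the trace of the second
fundamental form of f (`meanCurvature_eq_zero_of_inner_traceHessian`), so f is minimal. -/

namespace CylinderImmersion

/-! ### Second derivatives in a vector space. -/

section Calculus
variable {E V : Type*} [NormedAddCommGroup E] [NormedSpace ℝ E]
    [NormedAddCommGroup V] [InnerProductSpace ℝ V] {u : E → V} {x : E}

theorem hasFDerivAt_fderiv_apply (hu : ContDiffAt ℝ ∞ u x) (v : E) :
    HasFDerivAt (fun y => fderiv ℝ u y v) ((fderiv ℝ (fderiv ℝ u) x).flip v) x := by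
  have h : DifferentiableAt ℝ (fderiv ℝ u) x :=
    (hu.fderiv_right (m := 1) (by norm_cast)).differentiableAt one_ne_zero
  have := h.hasFDerivAt.clm_apply (hasFDerivAt_const v x)
  simpa using this

theorem fderiv_fderiv_comm (hu : ContDiffAt ℝ ∞ u x) (v w : E) :
    fderiv ℝ (fderiv ℝ u) x v w = fderiv ℝ (fderiv ℝ u) x w v :=
  (hu.isSymmSndFDerivAt (by
    rw [minSmoothness_of_isRCLikeNormedField]; exact WithTop.coe_le_coe.2 le_top)).eq v w

theorem fderiv_inner_fderiv (hu : ContDiffAt ℝ ∞ u x) (v w z : E) :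
    fderiv ℝ (fun y => inner ℝ (fderiv ℝ u y v) (fderiv ℝ u y w)) x z =
      inner ℝ (fderiv ℝ u x v) (fderiv ℝ (fderiv ℝ u) x z w) +
        inner ℝ (fderiv ℝ (fderiv ℝ u) x z v) (fderiv ℝ u x w) := by
  rw [((hasFDerivAt_fderiv_apply hu v).inner ℝ (hasFDerivAt_fderiv_apply hu w)).fderiv]
  simp

end Calculus

/-! ### Smooth maps read in the preferred chart. -/

section Chart
variable {E H M V : Type*} [NormedAddCommGroup E] [NormedSpace ℝ E]
    [TopologicalSpace H] {I : ModelWithCorners ℝ E H} [I.Boundaryless]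
    [TopologicalSpace M] [ChartedSpace H M] [IsManifold I ∞ M]
    [NormedAddCommGroup V] [NormedSpace ℝ V] {Φ : M → V}

theorem contDiffAt_comp_extChartAt_symm (hΦ : ContMDiff I 𝓘(ℝ, V) ∞ Φ) (p : M) {x : E}
    (hx : x ∈ (extChartAt I p).target) : ContDiffAt ℝ ∞ (Φ ∘ (extChartAt I p).symm) x := by
  rw [← contMDiffAt_iff_contDiffAt]
  exact hΦ.contMDiffAt.comp x
    ((contMDiffOn_extChartAt_symm p).contMDiffAt (extChartAt_target_mem_nhds' hx))

theorem fderiv_comp_extChartAt_symm (hΦ : ContMDiff I 𝓘(ℝ, V) ∞ Φ) (p : M) {x : E}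
    (hx : x ∈ (extChartAt I p).target) (v : E) :
    fderiv ℝ (Φ ∘ (extChartAt I p).symm) x v =
      mvfderiv I Φ ((extChartAt I p).symm x)
        (mfderiv 𝓘(ℝ, E) I (extChartAt I p).symm x v) := by
  rw [← mfderiv_eq_fderiv, mfderiv_comp x (hΦ.contMDiffAt.mdifferentiableAt (by simp))
    (((contMDiffOn_extChartAt_symm (n := ∞) p).contMDiffAt
      (extChartAt_target_mem_nhds' hx)).mdifferentiableAt (by simp))]
  rfl

-- At the centre of the chart no chart differential appears: the tangent space at `p` is the model
-- space, identified through this very chart.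
omit [IsManifold I ∞ M] in
theorem fderiv_comp_extChartAt_symm_self (hΦ : ContMDiff I 𝓘(ℝ, V) ∞ Φ) (p : M) :
    fderiv ℝ (Φ ∘ (extChartAt I p).symm) (extChartAt I p p) = mvfderiv I Φ p := by
  have h : MDifferentiableAt I 𝓘(ℝ, V) Φ p := hΦ.contMDiffAt.mdifferentiableAt (by simp)
  rw [mvfderiv, h.mfderiv, I.range_eq_univ, fderivWithin_univ]
  rfl

/-- A smooth function on a connected manifold with vanishing differential is constant. -/
theorem eq_of_mvfderiv_eq_zero [PreconnectedSpace M] (hΦ : ContMDiff I 𝓘(ℝ, V) ∞ Φ)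
    (h : ∀ p v, mvfderiv I Φ p v = 0) (p q : M) : Φ p = Φ q := by
  refine IsLocallyConstant.apply_eq_of_preconnectedSpace ?_ p q
  rw [IsLocallyConstant.iff_eventually_eq]
  intro p
  -- A ball inside the chart target is used because it is convex, hence preconnected.
  obtain ⟨r, hr, hball⟩ := Metric.mem_nhds_iff.1 (extChartAt_target_mem_nhds (I := I) p)
  have hx := mem_extChartAt_source (I := I) p
  filter_upwards [(continuousAt_extChartAt (I := I) p).preimage_mem_nhds (Metric.ball_mem_nhds _ hr),
    extChartAt_source_mem_nhds (I := I) p] with y hy hys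
  have key := Metric.isOpen_ball.is_const_of_fderiv_eq_zero (𝕜 := ℝ)
    (f := Φ ∘ (extChartAt I p).symm) (convex_ball (extChartAt I p p) r).isPreconnected
    (fun z hz => ((contDiffAt_comp_extChartAt_symm hΦ p (hball hz)).differentiableAt
      (by simp)).differentiableWithinAt)
    (fun z hz => by
      ext v
      rw [fderiv_comp_extChartAt_symm hΦ p (hball hz), h]
      rfl) hy (Metric.mem_ball_self hr)
  simpa only [Function.comp_apply, (extChartAt I p).left_inv hys,
    (extChartAt I p).left_inv hx] using key

end Chart

/-! ### Expansion in an orthonormal frame. -/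

section Frame
variable {E H M V : Type*} [NormedAddCommGroup E] [NormedSpace ℝ E] [FiniteDimensional ℝ E]
    [TopologicalSpace H] {I : ModelWithCorners ℝ E H} [TopologicalSpace M] [ChartedSpace H M]
    [IsManifold I 1 M]

open scoped Bundle in
theorem sum_orthonormalFrame (g : SmoothMetric I M) (p : M) (v : TangentSpace I p) :
    ∑ a, g.inner p (orthonormalFrame g p a) v • orthonormalFrame g p a = v := by
  let : Bundle.RiemannianBundle (fun p : M => TangentSpace I p) := ⟨g.toRiemannianMetric⟩
  have : FiniteDimensional ℝ (TangentSpace I p) := inferInstanceAs (FiniteDimensional ℝ E)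
  exact (stdOrthonormalBasis ℝ (TangentSpace I p)).sum_repr' v

theorem metric_inner_self (g : SmoothMetric I M) (p : M) (v : TangentSpace I p) :
    g.inner p v v = ∑ a, g.inner p (orthonormalFrame g p a) v ^ 2 := by
  conv_lhs => rw [← sum_orthonormalFrame g p v]
  simp only [map_sum, map_smul, sum_apply, smul_apply,
    orthonormalFrame_inner]
  simp [sq]

end Frame

/-! ### The Koszul formula for an induced metric. -/

section Koszul
variable {E H M V : Type*} [NormedAddCommGroup E] [NormedSpace ℝ E] [FiniteDimensional ℝ E]
    [TopologicalSpace H] {I : ModelWithCorners ℝ E H} [I.Boundaryless]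
    [TopologicalSpace M] [ChartedSpace H M] [IsManifold I ∞ M]
    [NormedAddCommGroup V] [InnerProductSpace ℝ V] {Φ : M → V} {g : SmoothMetric I M}

-- Writing u for Φ in the chart, the metric coefficients are ⟨∂_v u, ∂_w u⟩. Their derivatives give
-- six terms in the Koszul expression; by symmetry of D²u four cancel and two coincide.
omit [FiniteDimensional ℝ E] in
theorem christoffelFirst_eq_inner (hΦ : ContMDiff I 𝓘(ℝ, V) ∞ Φ)
    (hg : ∀ q (v w : TangentSpace I q),
      g.inner q v w = inner ℝ (mvfderiv I Φ q v) (mvfderiv I Φ q w))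
    (p : M) (v w z : E) :
    christoffelFirst g p v w z =
      inner ℝ (fderiv ℝ (fderiv ℝ (Φ ∘ (extChartAt I p).symm)) (extChartAt I p p) v w)
        (fderiv ℝ (Φ ∘ (extChartAt I p).symm) (extChartAt I p p) z) := by
  have hu := contDiffAt_comp_extChartAt_symm hΦ p (mem_extChartAt_target (I := I) p)
  have h (v w : E) : chartMetric g p v w =ᶠ[nhds (extChartAt I p p)] fun y =>
      inner ℝ (fderiv ℝ (Φ ∘ (extChartAt I p).symm) y v)
        (fderiv ℝ (Φ ∘ (extChartAt I p).symm) y w) := by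
    filter_upwards [extChartAt_target_mem_nhds (I := I) p] with y hy
    rw [chartMetric, hg, fderiv_comp_extChartAt_symm hΦ p hy, fderiv_comp_extChartAt_symm hΦ p hy]
  rw [christoffelFirst, (h _ _).fderiv_eq, (h _ _).fderiv_eq, (h _ _).fderiv_eq,
    fderiv_inner_fderiv hu, fderiv_inner_fderiv hu, fderiv_inner_fderiv hu,
    fderiv_fderiv_comm hu w v, fderiv_fderiv_comm hu z v, fderiv_fderiv_comm hu z w,
    real_inner_comm _ (fderiv ℝ (fderiv ℝ _) _ v z)]
  ring

/-- The second fundamental form of an isometric immersion into an inner product space is normal. -/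
theorem inner_fderiv_fderiv_sub_christoffel (hΦ : ContMDiff I 𝓘(ℝ, V) ∞ Φ)
    (hg : ∀ q (v w : TangentSpace I q),
      g.inner q v w = inner ℝ (mvfderiv I Φ q v) (mvfderiv I Φ q w))
    (p : M) (v w z : E) :
    inner ℝ (fderiv ℝ (fderiv ℝ (Φ ∘ (extChartAt I p).symm)) (extChartAt I p p) v w
      - fderiv ℝ (Φ ∘ (extChartAt I p).symm) (extChartAt I p p) (christoffel g p v w))
      (fderiv ℝ (Φ ∘ (extChartAt I p).symm) (extChartAt I p p) z) = 0 := by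
  have hA (v w : E) : g.inner p v w =
      inner ℝ (fderiv ℝ (Φ ∘ (extChartAt I p).symm) (extChartAt I p p) v)
        (fderiv ℝ (Φ ∘ (extChartAt I p).symm) (extChartAt I p p) w) := by
    rw [fderiv_comp_extChartAt_symm_self hΦ]
    exact hg p v w
  -- The frame is retyped with values in `E`, so that linear maps on the model space apply to it.
  obtain ⟨e, he⟩ : ∃ e : Fin (finrank ℝ E) → E, e = orthonormalFrame g p := ⟨_, rfl⟩
  have hsum : ∑ a, g.inner p (e a) z • e a = z := by
    rw [he]
    exact sum_orthonormalFrame g p z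
  have hΓ : christoffel g p v w = ∑ a, christoffelFirst g p v w (e a) • e a := by
    rw [he]
    rfl
  have h2 := congrArg (fderiv ℝ (Φ ∘ (extChartAt I p).symm) (extChartAt I p p)) hsum
  rw [map_sum] at h2
  rw [inner_sub_left, sub_eq_zero, hΓ, map_sum, sum_inner]
  conv_lhs => rw [← h2, inner_sum]
  refine Finset.sum_congr rfl fun a _ => ?_
  rw [map_smul, map_smul, inner_smul_right, real_inner_smul_left,
    christoffelFirst_eq_inner hΦ hg, hA, mul_comm]

end Koszul

/-! ### The second-order chain rule. -/

section Calculus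
variable {E E' V : Type*} [NormedAddCommGroup E] [NormedSpace ℝ E]
    [NormedAddCommGroup E'] [NormedSpace ℝ E'] [NormedAddCommGroup V] [NormedSpace ℝ V]

theorem fderiv_fderiv_comp {w : E' → V} {u : E → E'} {x : E} (hw : ContDiffAt ℝ ∞ w (u x))
    (hu : ContDiffAt ℝ ∞ u x) (v v' : E) :
    fderiv ℝ (fderiv ℝ (w ∘ u)) x v v' =
      fderiv ℝ (fderiv ℝ w) (u x) (fderiv ℝ u x v) (fderiv ℝ u x v') +
        fderiv ℝ w (u x) (fderiv ℝ (fderiv ℝ u) x v v') := by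
  have hw1 := (hw.of_le (m := 1) (by norm_cast)).eventually (by simp)
  have hu1 := (hu.of_le (m := 1) (by norm_cast)).eventually (by simp)
  have h : fderiv ℝ (w ∘ u) =ᶠ[nhds x] fun y => (fderiv ℝ w (u y)).comp (fderiv ℝ u y) := by
    filter_upwards [hu.continuousAt.eventually hw1, hu1] with y hy hy'
    exact fderiv_comp y (hy.differentiableAt one_ne_zero) (hy'.differentiableAt one_ne_zero)
  have hd : DifferentiableAt ℝ (fderiv ℝ w) (u x) :=
    (hw.fderiv_right (m := 1) (by norm_cast)).differentiableAt one_ne_zero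
  have hd' : DifferentiableAt ℝ (fderiv ℝ u) x :=
    (hu.fderiv_right (m := 1) (by norm_cast)).differentiableAt one_ne_zero
  have h' : HasFDerivAt (fun y => fderiv ℝ w (u y))
      ((fderiv ℝ (fderiv ℝ w) (u x)).comp (fderiv ℝ u x)) x :=
    hd.hasFDerivAt.comp x (hu.differentiableAt (by simp)).hasFDerivAt
  rw [h.fderiv_eq, (h'.clm_comp hd'.hasFDerivAt).fderiv]
  simp [add_comm]

end Calculus

/-! ### Hessian and Laplacian of vector-valued maps. -/

section Laplacian
variable {E H M V : Type*} [NormedAddCommGroup E] [NormedSpace ℝ E] [FiniteDimensional ℝ E]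
    [TopologicalSpace H] {I : ModelWithCorners ℝ E H}
    [TopologicalSpace M] [ChartedSpace H M] [IsManifold I ∞ M]
    [NormedAddCommGroup V] [NormedSpace ℝ V]

/-- The Hessian of a vector valued function. -/
noncomputable def vectorHessian (g : SmoothMetric I M) (Φ : M → V) (p : M) (v w : TangentSpace I p) : V :=
  fderiv ℝ (fderiv ℝ (Φ ∘ (extChartAt I p).symm)) (extChartAt I p p) v w
    - fderiv ℝ (Φ ∘ (extChartAt I p).symm) (extChartAt I p p) (christoffel g p v w)

theorem vectorHessian_apply (g : SmoothMetric I M) (Φ : M → V) (p : M) (v w : E) :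
    vectorHessian g Φ p v w =
      fderiv ℝ (fderiv ℝ (Φ ∘ (extChartAt I p).symm)) (extChartAt I p p) v w
        - fderiv ℝ (Φ ∘ (extChartAt I p).symm) (extChartAt I p p) (christoffel g p v w) := rfl

/-- The trace of the Hessian of a vector valued function. -/
noncomputable def traceHessian (g : SmoothMetric I M) (Φ : M → V) (p : M) : V :=
  ∑ a, vectorHessian g Φ p (orthonormalFrame g p a) (orthonormalFrame g p a)

/-- Coordinate projections are linear, so they commute with both derivatives. This replaces the
componentwise Laplacian by a vector that can be paired with dF. -/
theorem vectorLaplacian_eq_traceHessian [I.Boundaryless] {N : ℕ} (g : SmoothMetric I M)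
    {F : M → EuclideanSpace ℝ (Fin N)} (hF : ContMDiff I 𝓘(ℝ, EuclideanSpace ℝ (Fin N)) ∞ F)
    (p : M) : vectorLaplacian g F p = traceHessian g F p := by
  have hu (y : E) (hy : y ∈ (extChartAt I p).target) := contDiffAt_comp_extChartAt_symm hF p hy
  have h1 (i : Fin N) (y : E) (hy : y ∈ (extChartAt I p).target) :
      fderiv ℝ ((fun q => F q i) ∘ (extChartAt I p).symm) y =
        (EuclideanSpace.proj i : EuclideanSpace ℝ (Fin N) →L[ℝ] ℝ).comp
          (fderiv ℝ (F ∘ (extChartAt I p).symm) y) :=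
    (((EuclideanSpace.proj i : EuclideanSpace ℝ (Fin N) →L[ℝ] ℝ).hasFDerivAt).comp y
      ((hu y hy).differentiableAt (by simp)).hasFDerivAt).fderiv
  have hx := mem_extChartAt_target (I := I) p
  have h2 (i : Fin N) (v w : E) :
      fderiv ℝ (fderiv ℝ ((fun q => F q i) ∘ (extChartAt I p).symm)) (extChartAt I p p) v w =
        (fderiv ℝ (fderiv ℝ (F ∘ (extChartAt I p).symm)) (extChartAt I p p) v w) i := by
    have h : fderiv ℝ ((fun q => F q i) ∘ (extChartAt I p).symm) =ᶠ[nhds (extChartAt I p p)]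
        fun y => (EuclideanSpace.proj i : EuclideanSpace ℝ (Fin N) →L[ℝ] ℝ).comp
          (fderiv ℝ (F ∘ (extChartAt I p).symm) y) := by
      filter_upwards [extChartAt_target_mem_nhds (I := I) p] with y hy using h1 i y hy
    have hd : DifferentiableAt ℝ (fderiv ℝ (F ∘ (extChartAt I p).symm)) (extChartAt I p p) :=
      ((hu _ hx).fderiv_right (m := 1) (by norm_cast)).differentiableAt one_ne_zero
    rw [h.fderiv_eq, ((hasFDerivAt_const _ _).clm_comp hd.hasFDerivAt).fderiv]
    simp
  have h3 (i : Fin N) (v w : E) :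
      hessian g (fun q => F q i) p v w = vectorHessian g F p v w i := by
    change fderiv ℝ (fderiv ℝ ((fun q => F q i) ∘ (extChartAt I p).symm)) (extChartAt I p p) v w -
      fderiv ℝ ((fun q => F q i) ∘ (extChartAt I p).symm) (extChartAt I p p) (christoffel g p v w) = _
    rw [h1 i _ hx, vectorHessian_apply, h2]
    rfl
  ext i
  simp only [vectorLaplacian, laplacian, traceHessian, WithLp.ofLp_sum, Finset.sum_apply]
  exact Finset.sum_congr rfl fun a _ => h3 i _ _

end Laplacian

/-! ### Normality of the Laplacian; tangential projections. -/

section Frame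
variable {E H M V : Type*} [NormedAddCommGroup E] [NormedSpace ℝ E] [FiniteDimensional ℝ E]
    [TopologicalSpace H] {I : ModelWithCorners ℝ E H} [I.Boundaryless]
    [TopologicalSpace M] [ChartedSpace H M] [IsManifold I ∞ M]
    [NormedAddCommGroup V] [InnerProductSpace ℝ V] {Φ : M → V} {g : SmoothMetric I M}

theorem inner_vectorHessian (hΦ : ContMDiff I 𝓘(ℝ, V) ∞ Φ)
    (hg : ∀ q (v w : TangentSpace I q),
      g.inner q v w = inner ℝ (mvfderiv I Φ q v) (mvfderiv I Φ q w))
    (p : M) (v w z : TangentSpace I p) :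
    inner ℝ (vectorHessian g Φ p v w) (mvfderiv I Φ p z) = 0 := by
  have := inner_fderiv_fderiv_sub_christoffel hΦ hg p v w z
  rwa [← fderiv_comp_extChartAt_symm_self hΦ]

theorem inner_traceHessian (hΦ : ContMDiff I 𝓘(ℝ, V) ∞ Φ)
    (hg : ∀ q (v w : TangentSpace I q),
      g.inner q v w = inner ℝ (mvfderiv I Φ q v) (mvfderiv I Φ q w))
    (p : M) (z : TangentSpace I p) :
    inner ℝ (traceHessian g Φ p) (mvfderiv I Φ p z) = 0 := by
  rw [traceHessian, sum_inner]
  exact Finset.sum_eq_zero fun a _ => inner_vectorHessian hΦ hg p _ _ z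

-- Parseval: dF carries the frame to an orthonormal basis of its range, and `u` differs from its
-- projection by a vector normal to that range.
omit [I.Boundaryless] in
theorem norm_tangentialProjection_sq {N : ℕ} {F : M → EuclideanSpace ℝ (Fin N)}
    (hg : ∀ q (v w : TangentSpace I q),
      g.inner q v w = inner ℝ (mvfderiv I F q v) (mvfderiv I F q w))
    (p : M) (u : EuclideanSpace ℝ (Fin N)) :
    ‖tangentialProjection I F p u‖ ^ 2 =
      ∑ a, inner ℝ (mvfderiv I F p (orthonormalFrame g p a)) u ^ 2 := by
  obtain ⟨z, hz⟩ : tangentialProjection I F p u ∈ (mvfderiv I F p).range :=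
    Submodule.starProjection_apply_mem _ _
  have hz : mvfderiv I F p z = tangentialProjection I F p u := hz
  rw [← hz, ← real_inner_self_eq_norm_sq, ← hg, metric_inner_self]
  refine Finset.sum_congr rfl fun a _ => ?_
  have h : inner ℝ (mvfderiv I F p (orthonormalFrame g p a)) (u - tangentialProjection I F p u) = 0 :=
    Submodule.sub_starProjection_mem_orthogonal (K := (mvfderiv I F p).range) u _ ⟨_, rfl⟩
  rw [inner_sub_right, sub_eq_zero] at h
  rw [hg, hz, h]

end Frame

/-! ### Second fundamental form of a composition. -/

section Gauss
variable {E H M E' H' N V : Type*} [NormedAddCommGroup E] [NormedSpace ℝ E] [FiniteDimensional ℝ E]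
    [TopologicalSpace H] {I : ModelWithCorners ℝ E H} [I.Boundaryless]
    [TopologicalSpace M] [ChartedSpace H M] [IsManifold I ∞ M]
    [NormedAddCommGroup E'] [NormedSpace ℝ E'] [FiniteDimensional ℝ E']
    [TopologicalSpace H'] {J : ModelWithCorners ℝ E' H'} [J.Boundaryless]
    [TopologicalSpace N] [ChartedSpace H' N] [IsManifold J ∞ N]
    [NormedAddCommGroup V]

/-- The composition formula for second fundamental forms. -/
theorem vectorHessian_comp [NormedSpace ℝ V] (gM : SmoothMetric I M) (gN : SmoothMetric J N)
    {f : M → N} (hf : ContMDiff I J ∞ f) {Ψ : N → V} (hΨ : ContMDiff J 𝓘(ℝ, V) ∞ Ψ) (p : M)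
    (v w : E) :
    vectorHessian gM (Ψ ∘ f) p v w =
      vectorHessian gN Ψ (f p) (fderiv ℝ (writtenInExtChartAt I J p f) (extChartAt I p p) v)
        (fderiv ℝ (writtenInExtChartAt I J p f) (extChartAt I p p) w)
      + mvfderiv J Ψ (f p) (secondFundamentalForm gM gN f p v w) := by
  have hf1 : ContDiffAt ℝ ∞ (writtenInExtChartAt I J p f) (extChartAt I p p) := by
    have := (contMDiffAt_iff.1 (hf p)).2
    rwa [I.range_eq_univ, contDiffWithinAt_univ] at this
  have hfx : writtenInExtChartAt I J p f (extChartAt I p p) = extChartAt J (f p) (f p) := by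
    simp [writtenInExtChartAt]
  have hΨ1 : ContDiffAt ℝ ∞ (Ψ ∘ (extChartAt J (f p)).symm)
      (writtenInExtChartAt I J p f (extChartAt I p p)) := by
    rw [hfx]
    exact contDiffAt_comp_extChartAt_symm hΨ (f p) (mem_extChartAt_target _)
  have hev : (Ψ ∘ f) ∘ (extChartAt I p).symm =ᶠ[nhds (extChartAt I p p)]
      (Ψ ∘ (extChartAt J (f p)).symm) ∘ writtenInExtChartAt I J p f := by
    have h : Filter.Tendsto (f ∘ (extChartAt I p).symm) (nhds (extChartAt I p p)) (nhds (f p)) := by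
      have h := hf.continuous.continuousAt.tendsto.comp
        (continuousAt_extChartAt_symm (I := I) p).tendsto
      rwa [extChartAt_to_inv] at h
    filter_upwards [h.eventually (extChartAt_source_mem_nhds (I := J) (f p))] with y hy
    have hy' := (extChartAt J (f p)).left_inv hy
    simp only [writtenInExtChartAt, Function.comp_apply] at hy' ⊢
    rw [hy']
  have hα : mvfderiv J Ψ (f p) (secondFundamentalForm gM gN f p v w) =
      fderiv ℝ (Ψ ∘ (extChartAt J (f p)).symm) (extChartAt J (f p) (f p))
        (fderiv ℝ (fderiv ℝ (writtenInExtChartAt I J p f)) (extChartAt I p p) v w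
          - fderiv ℝ (writtenInExtChartAt I J p f) (extChartAt I p p) (christoffel gM p v w)
          + christoffel gN (f p) (fderiv ℝ (writtenInExtChartAt I J p f) (extChartAt I p p) v)
            (fderiv ℝ (writtenInExtChartAt I J p f) (extChartAt I p p) w)) := by
    rw [fderiv_comp_extChartAt_symm_self hΨ]
    rfl
  -- The Christoffel term of `gN` is subtracted in the Hessian of `Ψ` and added in the second
  -- fundamental form of `f`, so it cancels.
  rw [hα, vectorHessian_apply, hev.fderiv_eq, hev.fderiv.fderiv_eq, fderiv_fderiv_comp hΨ1 hf1,
    fderiv_comp _ (hΨ1.differentiableAt (by simp)) (hf1.differentiableAt (by simp)),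
    vectorHessian_apply,
    hfx, map_add, map_sub]
  simp only [ContinuousLinearMap.comp_apply]
  abel

/-- In the composition formula the Hessian of `Ψ` is normal to the image of `Ψ`, so a tangential
pairing sees only the second fundamental form of `f`. -/
theorem inner_vectorHessian_comp [InnerProductSpace ℝ V] (gM : SmoothMetric I M)
    {gN : SmoothMetric J N} {f : M → N} (hf : ContMDiff I J ∞ f) {Ψ : N → V}
    (hΨ : ContMDiff J 𝓘(ℝ, V) ∞ Ψ)
    (hg : ∀ q (v w : TangentSpace J q),
      gN.inner q v w = inner ℝ (mvfderiv J Ψ q v) (mvfderiv J Ψ q w)) (p : M) (v w : E)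
    (z : TangentSpace J (f p)) :
    inner ℝ (vectorHessian gM (Ψ ∘ f) p v w) (mvfderiv J Ψ (f p) z) =
      inner ℝ (mvfderiv J Ψ (f p) (secondFundamentalForm gM gN f p v w))
        (mvfderiv J Ψ (f p) z) := by
  rw [vectorHessian_comp gM gN hf hΨ, inner_add_left, add_eq_right]
  exact inner_vectorHessian hΨ hg (f p) _ _ z

/-- An isometric immersion `f` is minimal at `p` if the trace of the Hessian of `Ψ ∘ f`, for an
isometric immersion `Ψ` into an inner product space, is normal to the image of `Ψ`. -/
theorem meanCurvature_eq_zero_of_inner_traceHessian [InnerProductSpace ℝ V] {gM : SmoothMetric I M}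
    {gN : SmoothMetric J N} {f : M → N} (hf : ContMDiff I J ∞ f) {Ψ : N → V}
    (hΨ : ContMDiff J 𝓘(ℝ, V) ∞ Ψ)
    (hg : ∀ q (v w : TangentSpace J q),
      gN.inner q v w = inner ℝ (mvfderiv J Ψ q v) (mvfderiv J Ψ q w)) (p : M)
    (h : ∀ z : TangentSpace J (f p),
      inner ℝ (traceHessian gM (Ψ ∘ f) p) (mvfderiv J Ψ (f p) z) = 0) :
    meanCurvature gM gN f p = 0 := by
  rw [meanCurvature]
  set s := ∑ a, secondFundamentalForm gM gN f p (orthonormalFrame gM p a) (orthonormalFrame gM p a)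
    with hs
  have h1 (z : TangentSpace J (f p)) : gN.inner (f p) s z = 0 := by
    rw [hg, ← h z, hs, map_sum, traceHessian, sum_inner, sum_inner]
    exact Finset.sum_congr rfl fun a _ => (inner_vectorHessian_comp gM hf hΨ hg p _ _ z).symm
  have h2 : s = 0 := by
    by_contra h0
    exact (gN.pos _ _ h0).ne' (h1 s)
  rw [h2, smul_zero]

end Gauss

/-! ### Quadratic forms along an immersion. -/

section QuadraticForm
variable {E H M V : Type*} [NormedAddCommGroup E] [NormedSpace ℝ E]
    [TopologicalSpace H] {I : ModelWithCorners ℝ E H}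
    [TopologicalSpace M] [ChartedSpace H M] [IsManifold I ∞ M]
    [NormedAddCommGroup V] [InnerProductSpace ℝ V] {F : M → V} {P : V →L[ℝ] V}

omit [IsManifold I ∞ M] in
theorem contMDiff_inner_clm_self (hF : ContMDiff I 𝓘(ℝ, V) ∞ F) (P : V →L[ℝ] V) :
    ContMDiff I 𝓘(ℝ, ℝ) ∞ fun q => inner ℝ (P (F q)) (F q) :=
  (P.contDiff.inner ℝ contDiff_id).contMDiff.comp hF

theorem mvfderiv_inner_clm_self [I.Boundaryless] (hF : ContMDiff I 𝓘(ℝ, V) ∞ F)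
    (hP : ∀ u w, inner ℝ (P u) w = inner ℝ (P w) u) (p : M) (v : TangentSpace I p) :
    mvfderiv I (fun q => inner ℝ (P (F q)) (F q)) p v = 2 * inner ℝ (P (F p)) (mvfderiv I F p v) := by
  have hx := mem_extChartAt_target (I := I) p
  have hu := ((contDiffAt_comp_extChartAt_symm hF p hx).differentiableAt (by simp)).hasFDerivAt
  have h := (P.hasFDerivAt.comp _ hu).inner ℝ hu
  rw [← fderiv_comp_extChartAt_symm_self (contMDiff_inner_clm_self hF P),
    ← fderiv_comp_extChartAt_symm_self hF]
  refine (congrArg (fun A : E →L[ℝ] ℝ => A v) h.fderiv).trans ?_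
  have hp : (extChartAt I p).symm (extChartAt I p p) = p := extChartAt_to_inv p
  obtain ⟨w, hw⟩ : ∃ w : E, w = v := ⟨v, rfl⟩
  rw [← hw]
  simp only [ContinuousLinearMap.comp_apply, ContinuousLinearMap.prod_apply,
    fderivInnerCLM_apply, Function.comp_apply, hp]
  rw [hP (fderiv ℝ (F ∘ (extChartAt I p).symm) (extChartAt I p p) w)]
  exact (two_mul _).symm

/-- If the quadratic form `⟪P F, F⟫` is constant, then `⟪P F, Δ F⟫ = -trace ⟪P dF, dF⟫`. -/
theorem inner_clm_traceHessian [FiniteDimensional ℝ E] [I.Boundaryless] {g : SmoothMetric I M}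
    (hF : ContMDiff I 𝓘(ℝ, V) ∞ F)
    (h : ∀ p v, inner ℝ (P (F p)) (mvfderiv I F p v) = 0) (p : M) :
    inner ℝ (P (F p)) (traceHessian g F p) =
      -∑ a, inner ℝ (P (mvfderiv I F p (orthonormalFrame g p a)))
        (mvfderiv I F p (orthonormalFrame g p a)) := by
  have hx := mem_extChartAt_target (I := I) p
  have hu := contDiffAt_comp_extChartAt_symm hF p hx
  have hp : (extChartAt I p).symm (extChartAt I p p) = p := extChartAt_to_inv p
  have key (v : E) : inner ℝ (P (F p)) (vectorHessian g F p v v) =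
      -inner ℝ (P (mvfderiv I F p v)) (mvfderiv I F p v) := by
    -- The hypothesis holds at every point, so this function vanishes near the centre of the chart
    -- and may be differentiated in the direction `v`.
    have h0 : (fun y => inner ℝ (P ((F ∘ (extChartAt I p).symm) y))
        (fderiv ℝ (F ∘ (extChartAt I p).symm) y v)) =ᶠ[nhds (extChartAt I p p)] fun _ => 0 := by
      filter_upwards [extChartAt_target_mem_nhds (I := I) p] with y hy
      rw [fderiv_comp_extChartAt_symm hF p hy]
      exact h _ _
    have h1 := congrArg (fun A : E →L[ℝ] ℝ => A v) h0.fderiv_eq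
    have h2 := (P.hasFDerivAt.comp _ (hu.differentiableAt (by simp)).hasFDerivAt).inner ℝ
      (hasFDerivAt_fderiv_apply hu v)
    have h3 := (congrArg (fun A : E →L[ℝ] ℝ => A v) h2.fderiv).symm.trans h1
    -- The Christoffel correction is an image under dF, so the hypothesis kills it as well.
    have h4 : inner ℝ (P (F p)) (fderiv ℝ (F ∘ (extChartAt I p).symm) (extChartAt I p p)
        (christoffel g p v v)) = 0 := by
      rw [fderiv_comp_extChartAt_symm_self hF]
      exact h p _
    have h5 : mvfderiv I F p v = fderiv ℝ (F ∘ (extChartAt I p).symm) (extChartAt I p p) v :=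
      (congrArg (fun A : E →L[ℝ] V => A v) (fderiv_comp_extChartAt_symm_self hF p)).symm
    rw [vectorHessian_apply, inner_sub_right, h4, h5]
    simp only [ContinuousLinearMap.comp_apply, ContinuousLinearMap.prod_apply,
      fderivInnerCLM_apply, Function.comp_apply, hp, ContinuousLinearMap.flip_apply,
      fderiv_const_apply, zero_apply] at h3
    linarith
  rw [traceHessian, inner_sum, ← Finset.sum_neg_distrib]
  exact Finset.sum_congr rfl fun a _ => key _

end QuadraticForm

/-! ### The projection onto the sphere factor and the geometry of the cylinder. -/

section Projection
variable {n k : ℕ}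
    (b : OrthonormalBasis (Fin (n + k + 1)) ℝ (EuclideanSpace ℝ (Fin (n + k + 1))))

/-- The orthogonal projection `u ↦ u - ∑ ⟨u, b_j⟩ b_j` onto `span {b_1, …, b_{n+1}}`. -/
noncomputable def sphereProjection :
    EuclideanSpace ℝ (Fin (n + k + 1)) →L[ℝ] EuclideanSpace ℝ (Fin (n + k + 1)) :=
  ContinuousLinearMap.id ℝ _ -
    ∑ j : Fin k, (innerSL ℝ (b (lineIndex j))).smulRight (b (lineIndex j))

theorem sphereProjection_apply (u : EuclideanSpace ℝ (Fin (n + k + 1))) :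
    sphereProjection b u = u - ∑ j : Fin k, inner ℝ u (b (lineIndex j)) • b (lineIndex j) := by
  simp [sphereProjection, sum_apply, real_inner_comm]

theorem inner_sphereProjection_eq_sub (u w : EuclideanSpace ℝ (Fin (n + k + 1))) :
    inner ℝ (sphereProjection b u) w =
      inner ℝ u w - ∑ j : Fin k, inner ℝ u (b (lineIndex j)) * inner ℝ w (b (lineIndex j)) := by
  rw [sphereProjection_apply, inner_sub_left, sum_inner]
  simp only [real_inner_smul_left, real_inner_comm w (b _)]

/-- In this form ⟨Pu, u⟩ is a sum of squares, which gives its sign and matches the equation of the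
cylinder. -/
theorem inner_sphereProjection (u w : EuclideanSpace ℝ (Fin (n + k + 1))) :
    inner ℝ (sphereProjection b u) w =
      ∑ a : Fin (n + 1), inner ℝ u (b (sphereIndex a)) * inner ℝ w (b (sphereIndex a)) := by
  have h : inner ℝ u w = ∑ i, inner ℝ u (b i) * inner ℝ w (b i) := by
    rw [← b.sum_inner_mul_inner]
    simp only [real_inner_comm w]
  rw [inner_sphereProjection_eq_sub, h, sum_index, add_sub_cancel_right]

theorem inner_sphereProjection_comm (u w : EuclideanSpace ℝ (Fin (n + k + 1))) :
    inner ℝ (sphereProjection b u) w = inner ℝ (sphereProjection b w) u := by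
  simp only [inner_sphereProjection, mul_comm]

theorem inner_sphereProjection_self_nonneg (u : EuclideanSpace ℝ (Fin (n + k + 1))) :
    0 ≤ inner ℝ (sphereProjection b u) u := by
  rw [inner_sphereProjection]
  exact Finset.sum_nonneg fun a _ => mul_self_nonneg _

theorem inner_sphereProjection_eq_zero {w : EuclideanSpace ℝ (Fin (n + k + 1))}
    (hw : inner ℝ (sphereProjection b w) w = 0) (u : EuclideanSpace ℝ (Fin (n + k + 1))) :
    inner ℝ (sphereProjection b u) w = 0 := by
  rw [inner_sphereProjection, Finset.sum_eq_zero_iff_of_nonneg fun _ _ => mul_self_nonneg _] at hw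
  rw [inner_sphereProjection]
  exact Finset.sum_eq_zero fun a ha => by rw [mul_self_eq_zero.1 (hw a ha), mul_zero]

/-- The linear isometry extending `cylinderInclusion`. -/
noncomputable def cylinderIsometry :
    WithLp 2 (EuclideanSpace ℝ (Fin (n + 1)) × EuclideanSpace ℝ (Fin k)) →ₗᵢ[ℝ]
      EuclideanSpace ℝ (Fin (n + k + 1)) :=
  LinearMap.isometryOfInner
    { toFun x := ∑ a : Fin (n + 1), x.fst a • b (sphereIndex a)
        + ∑ j : Fin k, x.snd j • b (lineIndex j)
      map_add' x y := by
        simp only [WithLp.add_fst, WithLp.add_snd, PiLp.add_apply, add_smul, Finset.sum_add_distrib]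
        abel
      map_smul' r x := by
        simp [mul_smul, Finset.smul_sum] }
    (fun x y => by
      have hl (i j : Fin k) : (lineIndex i : Fin (n + k + 1)) = lineIndex j ↔ i = j := by
        simp [lineIndex, Fin.ext_iff]
      simp [inner_add_left, inner_add_right, sum_inner, inner_sum, inner_smul_left,
        inner_smul_right, orthonormal_iff_ite.1 b.orthonormal, lineIndex_ne_sphereIndex,
        (lineIndex_ne_sphereIndex _ _).symm, sphereIndex_inj, hl, WithLp.prod_inner_apply,
        PiLp.inner_apply, mul_comm])

theorem contMDiff_cylinderInclusion (c : ℝ) :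
    ContMDiff (cylinderModel n k) 𝓘(ℝ, EuclideanSpace ℝ (Fin (n + k + 1))) ∞
      (cylinderInclusion b c) :=
  (cylinderIsometry b).toContinuousLinearMap.contDiff.contMDiff.comp (contMDiff_cylinderEmbedding c)

/-- The inclusion is the embedding followed by a linear isometry, so both induce the same metric;
hence `cylinderInclusion` can play the role of Ψ in the composition formula. -/
theorem cylinderMetric_inner_eq {c : ℝ} (hc : 0 < c) (q : Cylinder n k)
    (v w : TangentSpace (cylinderModel n k) q) :
    (cylinderMetric n k hc).inner q v w =
      inner ℝ (mvfderiv (cylinderModel n k) (cylinderInclusion b c) q v)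
        (mvfderiv (cylinderModel n k) (cylinderInclusion b c) q w) := by
  have h (v : TangentSpace (cylinderModel n k) q) :
      mvfderiv (cylinderModel n k) (cylinderInclusion b c) q v =
        cylinderIsometry b (mvfderiv (cylinderModel n k) (cylinderEmbedding c) q v) := by
    have h1 := (cylinderIsometry b).toContinuousLinearMap.hasMFDerivAt.comp q
      ((contMDiff_cylinderEmbedding c).contMDiffAt.mdifferentiableAt
        (by simp) : MDifferentiableAt _ _ _ q).hasMFDerivAt
    exact congrArg (fun A => A v) h1.mfderiv
  rw [h, h, (cylinderIsometry b).inner_map_map]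
  rfl

/-- The cylinder lies in the level set ⟨Pz, z⟩ = 1/c, and Pz is half the gradient of that quadratic
form, so it is normal to the cylinder. -/
theorem inner_sphereProjection_cylinderInclusion {c : ℝ} (hc : 0 < c) (q : Cylinder n k)
    (z : TangentSpace (cylinderModel n k) q) :
    inner ℝ (sphereProjection b (cylinderInclusion b c q))
      (mvfderiv (cylinderModel n k) (cylinderInclusion b c) q z) = 0 := by
  have h1 (q : Cylinder n k) :
      inner ℝ (sphereProjection b (cylinderInclusion b c q)) (cylinderInclusion b c q) = 1 / c := by
    have h : cylinderInclusion b c q ∈ Set.range (cylinderInclusion b c) := ⟨q, rfl⟩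
    rw [range_cylinderInclusion b hc] at h
    rw [inner_sphereProjection, ← h]
    simp only [sq]
  have h2 := mvfderiv_inner_clm_self (contMDiff_cylinderInclusion b c)
    (inner_sphereProjection_comm b) q z
  simp only [h1, mvfderiv_const] at h2
  have h3 : (0 : TangentSpace (cylinderModel n k) q →L[ℝ] ℝ) z = 0 := rfl
  rw [h3] at h2
  linarith

/-- The components of `f` are the frame coefficients of `F`, those of the sphere factor multiplied
by √c because `Cylinder` is modelled on the unit sphere. -/
theorem exists_contMDiff_cylinderInclusion_comp {E H M : Type*} [NormedAddCommGroup E]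
    [NormedSpace ℝ E] [TopologicalSpace H] {I : ModelWithCorners ℝ E H} [TopologicalSpace M]
    [ChartedSpace H M] [IsManifold I ∞ M] {F : M → EuclideanSpace ℝ (Fin (n + k + 1))}
    (hF : ContMDiff I 𝓘(ℝ, EuclideanSpace ℝ (Fin (n + k + 1))) ∞ F) {c : ℝ} (hc : 0 < c)
    (h : ∀ p, inner ℝ (sphereProjection b (F p)) (F p) = 1 / c) :
    ∃ f : M → Cylinder n k, ContMDiff I (cylinderModel n k) ∞ f ∧ F = cylinderInclusion b c ∘ f := by
  have := Fact.mk (@finrank_euclideanSpace_fin ℝ _ (n + 1))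
  have hs : √c ≠ 0 := (Real.sqrt_pos.2 hc).ne'
  have hS (p : M) : WithLp.toLp 2 (fun a : Fin (n + 1) => √c * inner ℝ (F p) (b (sphereIndex a))) ∈
      Metric.sphere (0 : EuclideanSpace ℝ (Fin (n + 1))) 1 := by
    have hp := h p
    rw [inner_sphereProjection] at hp
    rw [mem_sphere_zero_iff_norm, EuclideanSpace.norm_eq, Real.sqrt_eq_one]
    simp only [Real.norm_eq_abs, sq_abs, mul_pow, ← Finset.mul_sum, Real.sq_sqrt hc.le]
    simp only [sq, hp]
    exact mul_one_div_cancel hc.ne'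
  have h1 : ContMDiff I 𝓘(ℝ, EuclideanSpace ℝ (Fin (n + 1))) ∞ (fun p =>
      WithLp.toLp 2 (fun a : Fin (n + 1) => √c * inner ℝ (F p) (b (sphereIndex a)))) := by
    refine (?_ : ContDiff ℝ ∞ fun u : EuclideanSpace ℝ (Fin (n + k + 1)) =>
      WithLp.toLp 2 (fun a : Fin (n + 1) => √c * inner ℝ u (b (sphereIndex a)))).contMDiff.comp hF
    rw [contDiff_euclidean]
    exact fun a => contDiff_const.mul (contDiff_id.inner ℝ contDiff_const)
  have h2 : ContMDiff I 𝓘(ℝ, EuclideanSpace ℝ (Fin k)) ∞ (fun p =>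
      WithLp.toLp 2 (fun j : Fin k => inner ℝ (F p) (b (lineIndex j)))) := by
    refine (?_ : ContDiff ℝ ∞ fun u : EuclideanSpace ℝ (Fin (n + k + 1)) =>
      WithLp.toLp 2 (fun j : Fin k => inner ℝ u (b (lineIndex j)))).contMDiff.comp hF
    rw [contDiff_euclidean]
    exact fun a => contDiff_id.inner ℝ contDiff_const
  refine ⟨_, (h1.codRestrict_sphere hS).prodMk h2, ?_⟩
  funext p
  refine ((b.sum_repr' (F p)).symm).trans ?_
  rw [sum_index]
  simp [cylinderInclusion, cylinderEmbedding, hs, real_inner_comm]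

end Projection

/-! ### The image lies in the cylinder. -/

section Spherical
variable {n k : ℕ} {E H M : Type*} [NormedAddCommGroup E] [NormedSpace ℝ E] [FiniteDimensional ℝ E]
    [TopologicalSpace H] {I : ModelWithCorners ℝ E H}
    [TopologicalSpace M] [ChartedSpace H M] [IsManifold I ∞ M]
    (b : OrthonormalBasis (Fin (n + k + 1)) ℝ (EuclideanSpace ℝ (Fin (n + k + 1))))
    {g : SmoothMetric I M} {F : M → EuclideanSpace ℝ (Fin (n + k + 1))}

/-- The trace of `⟪P dF, dF⟫` for the projection `P` onto `span {b_1, …, b_{n+1}}`. -/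
theorem finrank_sub_sum_norm_tangentialProjection_sq
    (hg : ∀ q (v w : TangentSpace I q),
      g.inner q v w = inner ℝ (mvfderiv I F q v) (mvfderiv I F q w)) (p : M) :
    (finrank ℝ E : ℝ) - ∑ j : Fin k, ‖tangentialProjection I F p (b (lineIndex j))‖ ^ 2 =
      ∑ a, inner ℝ (sphereProjection b (mvfderiv I F p (orthonormalFrame g p a)))
        (mvfderiv I F p (orthonormalFrame g p a)) := by
  simp only [norm_tangentialProjection_sq hg, inner_sphereProjection_eq_sub, ← hg,
    orthonormalFrame_inner, Finset.sum_sub_distrib]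
  rw [Finset.sum_comm]
  simp [sq]

variable [I.Boundaryless]

/-- Pairing the equation with dF v kills the left side. If the trace vanishes at `p`, its
nonnegative terms all vanish, so P dF = 0 there; the zeros of the trace thus need no density
argument. -/
theorem inner_sphereProjection_mvfderiv_eq_zero (hF : ContMDiff I 𝓘(ℝ, EuclideanSpace ℝ (Fin (n + k + 1))) ∞ F)
    (hg : ∀ q (v w : TangentSpace I q),
      g.inner q v w = inner ℝ (mvfderiv I F q v) (mvfderiv I F q w)) {c : ℝ} (hc : c ≠ 0) {p : M}
    (hΔ : traceHessian g F p =
      (-c * ∑ a, inner ℝ (sphereProjection b (mvfderiv I F p (orthonormalFrame g p a)))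
        (mvfderiv I F p (orthonormalFrame g p a))) • sphereProjection b (F p))
    (v : TangentSpace I p) :
    inner ℝ (sphereProjection b (F p)) (mvfderiv I F p v) = 0 := by
  have h := inner_traceHessian hF hg p v
  rw [hΔ, real_inner_smul_left, mul_eq_zero, mul_eq_zero, neg_eq_zero] at h
  rcases h with (h | h) | h
  · exact absurd h hc
  · rw [Finset.sum_eq_zero_iff_of_nonneg
      fun _ _ => inner_sphereProjection_self_nonneg b _] at h
    rw [← sum_orthonormalFrame g p v, map_sum, inner_sum]
    refine Finset.sum_eq_zero fun a ha => ?_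
    rw [map_smul, real_inner_smul_right, inner_sphereProjection_eq_zero b (h a ha), mul_zero]
  · exact h

theorem inner_sphereProjection_self_eq_one_div [PreconnectedSpace M]
    (hF : ContMDiff I 𝓘(ℝ, EuclideanSpace ℝ (Fin (n + k + 1))) ∞ F)
    (hg : ∀ q (v w : TangentSpace I q),
      g.inner q v w = inner ℝ (mvfderiv I F q v) (mvfderiv I F q w)) {c : ℝ} (hc : c ≠ 0)
    (hΔ : ∀ p, traceHessian g F p =
      (-c * ∑ a, inner ℝ (sphereProjection b (mvfderiv I F p (orthonormalFrame g p a)))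
        (mvfderiv I F p (orthonormalFrame g p a))) • sphereProjection b (F p))
    {p₀ : M} (hp₀ : ∑ a, inner ℝ (sphereProjection b (mvfderiv I F p₀ (orthonormalFrame g p₀ a)))
        (mvfderiv I F p₀ (orthonormalFrame g p₀ a)) ≠ 0) (p : M) :
    inner ℝ (sphereProjection b (F p)) (F p) = 1 / c := by
  have h0 (p : M) (v : TangentSpace I p) :=
    inner_sphereProjection_mvfderiv_eq_zero b hF hg hc (hΔ p) v
  rw [eq_of_mvfderiv_eq_zero (contMDiff_inner_clm_self hF (sphereProjection b))
    (fun p v => by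
      rw [mvfderiv_inner_clm_self hF (inner_sphereProjection_comm b), h0, mul_zero]) p p₀]
  have h1 := inner_clm_traceHessian (g := g) hF h0 p₀
  -- P is a self-adjoint idempotent: |Pu|² = ⟨Pu, u⟩.
  have h2 (u : EuclideanSpace ℝ (Fin (n + k + 1))) :
      inner ℝ (sphereProjection b u) (sphereProjection b u) = inner ℝ (sphereProjection b u) u := by
    have hj (j : Fin k) : inner ℝ (sphereProjection b u) (b (lineIndex j)) = 0 := by
      rw [inner_sphereProjection]
      refine Finset.sum_eq_zero fun a _ => ?_
      rw [orthonormal_iff_ite.1 b.orthonormal, if_neg (lineIndex_ne_sphereIndex a j), mul_zero]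
    rw [inner_sphereProjection_eq_sub, real_inner_comm]
    simp [hj]
  rw [hΔ, real_inner_smul_right, h2] at h1
  rw [eq_div_iff hc]
  -- With τ the trace at `p₀`, `h1` reads -cτ⟨PF, F⟩ = -τ; nondegeneracy allows τ to be cancelled.
  apply mul_left_cancel₀ hp₀
  linarith

end Spherical

end CylinderImmersion

/-! ### Sign of the constant, factorization and minimality. -/

theorem mainTheorem1 {m n k : ℕ} {M : Type*} [TopologicalSpace M]
    [ChartedSpace (EuclideanSpace ℝ (Fin m)) M] [IsManifold (𝓡 m) ∞ M] [ConnectedSpace M]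
    (g : SmoothMetric (𝓡 m) M) (F : M → EuclideanSpace ℝ (Fin (n + k + 1)))
    (hF : IsIsometricImmersion g (euclideanMetric (EuclideanSpace ℝ (Fin (n + k + 1)))) F)
    (E : OrthonormalBasis (Fin (n + k + 1)) ℝ (EuclideanSpace ℝ (Fin (n + k + 1))))
    (c : ℝ) (hc : c ≠ 0)
    (hΔ : ∀ p, vectorLaplacian g F p =
      (-c * ((m : ℝ) - ∑ j : Fin k, ‖tangentialProjection (𝓡 m) F p (E (lineIndex j))‖ ^ 2)) •
        (F p - ∑ j : Fin k, inner ℝ (F p) (E (lineIndex j)) • E (lineIndex j)))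
    (hnd : ∃ p, ∑ j : Fin k, ‖tangentialProjection (𝓡 m) F p (E (lineIndex j))‖ ^ 2 ≠ (m : ℝ)) :
    ∃ hpos : 0 < c, ∃ f : M → Cylinder n k,
      IsMinimalIsometricImmersion g (cylinderMetric n k hpos) f ∧ F = cylinderInclusion E c ∘ f := by
  have hg (q : M) (v w : TangentSpace (𝓡 m) q) :
      g.inner q v w = inner ℝ (mvfderiv (𝓡 m) F q v) (mvfderiv (𝓡 m) F q w) :=
    (hF.isometric q v w).symm
  have htr (p : M) : (m : ℝ) -
      ∑ j : Fin k, ‖tangentialProjection (𝓡 m) F p (E (lineIndex j))‖ ^ 2 =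
        ∑ a, inner ℝ (sphereProjection E (mvfderiv (𝓡 m) F p (orthonormalFrame g p a)))
          (mvfderiv (𝓡 m) F p (orthonormalFrame g p a)) := by
    rw [← finrank_sub_sum_norm_tangentialProjection_sq E hg p, finrank_euclideanSpace_fin]
  simp only [htr, ← sphereProjection_apply, vectorLaplacian_eq_traceHessian g hF.smooth] at hΔ
  obtain ⟨p₀, hp₀⟩ := hnd
  have hp₀' := sub_ne_zero.2 hp₀.symm
  rw [htr] at hp₀'
  have hsph := inner_sphereProjection_self_eq_one_div E hF.smooth hg hc hΔ hp₀'
  -- The squared length 1/c is nonnegative and c ≠ 0.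
  have hpos : 0 < c := by
    have h := inner_sphereProjection_self_nonneg E (F p₀)
    rw [hsph] at h
    exact lt_of_le_of_ne (one_div_nonneg.1 h) hc.symm
  obtain ⟨f, hf, hFf⟩ := exists_contMDiff_cylinderInclusion_comp E hF.smooth hpos hsph
  refine ⟨hpos, f, ⟨⟨hf, fun p v w => ?_⟩, fun p => ?_⟩, hFf⟩
  · have h (v : TangentSpace (𝓡 m) p) : mvfderiv (𝓡 m) F p v =
        mvfderiv (cylinderModel n k) (cylinderInclusion E c) (f p)
          (mfderiv (𝓡 m) (cylinderModel n k) f p v) := by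
      have h1 := ((contMDiff_cylinderInclusion E c).contMDiffAt.mdifferentiableAt
        (by simp) : MDifferentiableAt _ _ _ (f p)).hasMFDerivAt.comp p
        (hf.contMDiffAt.mdifferentiableAt (by simp) : MDifferentiableAt _ _ _ p).hasMFDerivAt
      rw [← hFf] at h1
      exact congrArg (fun A => A v) h1.mfderiv
    rw [cylinderMetric_inner_eq E, hg, h, h]
  · refine meanCurvature_eq_zero_of_inner_traceHessian hf (contMDiff_cylinderInclusion E c)
      (cylinderMetric_inner_eq E hpos) p fun z => ?_
    -- ΔF is a multiple of PF, which is normal to the cylinder at `f p`.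
    rw [← hFf, hΔ, real_inner_smul_left, hFf]
    rw [Function.comp_apply, inner_sphereProjection_cylinderInclusion E hpos, mul_zero]
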